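/- Let $r$ be a complex function on $\mathbb R\cup i\mathbb R$, regarded as a function of $z=k^2\in\mathbb R$ through a choice of a square root $k=k(z)$ of each $z\in\mathbb R$; write $L^p_z$ for $L^p(\mathbb R,dz)$. Suppose that $r\in L^2_z\cap L^\infty_z$ and that, for some $c_0>0$, $1-|r(k)|^2\ge c_0^2$ for almost every $k\in i\mathbb R$. For $x\in\mathbb R$ put $$J(x;k)=\begin{pmatrix}|r(k)|^2&\overline{r(k)}e^{-2ik^2x}\\ r(k)e^{2ik^2x}&0\end{pmatrix}\ (k\in\mathbb R),\qquad J(x;k)=\begin{pmatrix}-|r(k)|^2&-\overline{r(k)}e^{-2ik^2x}\\ r(k)e^{2ik^2x}&0\end{pmatrix}\ (k\in i\mathbb R\setminus\{0\}),$$ and, for $h\in L^2_z$, let $\mathcal P^-(h)(z)=\lim_{\varepsilon\downarrow0}\frac1{2\pi i}\int_{\mathbb R}\frac{h(s)}{s-(z-i\varepsilon)}\,ds$ for almost every $z\in\mathbb R$, applied entrywise to vectors and matrices. Then: (i) for every $x\in\mathbb R$ the equation $G_-=\mathcal P^-(G_-J)+\mathcal P^-(J)$ has a unique solution $G_-$ among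 the $2\times2$ matrix functions with entries in $L^2_z$; (ii) for every $x\in\mathbb R$ the operator $f\mapsto f-\mathcal P^-(fJ)$ on row vectors $f\in L^2_z(\mathbb R;\mathbb C^2)$ is well defined, bounded and boundedly invertible, and there is a constant $C>0$ depending only on $c_0$ and an upper bound for $\|r\|_{L^\infty_z}$ (in particular not on $x$) such that its inverse satisfies $\|(I-\mathcal P^-(\cdot\,J))^{-1}f\|_{L^2_z}\le C\|f\|_{L^2_z}$ for every row vector $f\in L^2_z$. -/

import Mathlib

open MeasureTheory Filter Topology
open scoped NNReal ENNReal

noncomputable section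

/-- The jump matrix is `V = I + J`; this is `J(x; k)` for `k` on `ℝ ∪ iℝ`.
The first branch is used for `k ∈ ℝ`, the second one for `k ∈ iℝ ∖ {0}`. -/
def jumpJ (r : ℂ → ℂ) (x : ℝ) (k : ℂ) : Matrix (Fin 2) (Fin 2) ℂ :=
  if k.im = 0 then
    !![(‖r k‖ ^ 2 : ℂ), star (r k) * Complex.exp (-2 * Complex.I * k ^ 2 * x);
       r k * Complex.exp (2 * Complex.I * k ^ 2 * x), 0]
  else
    !![-(‖r k‖ ^ 2 : ℂ), -(star (r k) * Complex.exp (-2 * Complex.I * k ^ 2 * x));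
       r k * Complex.exp (2 * Complex.I * k ^ 2 * x), 0]

/-- The Cauchy operator on the line, `(1 / 2πi) ∫ h(s) / (s - w) ds`. -/
def cauchyOp (h : ℝ → ℂ) (w : ℂ) : ℂ :=
  (2 * Real.pi * Complex.I)⁻¹ * ∫ s : ℝ, h s / ((s : ℂ) - w)

/-- `g = 𝒫⁻(h)` almost everywhere: for almost every `z ∈ ℝ` the limit of the Cauchy operator
of `h` at `z - iε` as `ε ↓ 0` exists and equals `g z`. -/
def IsPlemeljMinus (h g : ℝ → ℂ) : Prop :=
  ∀ᵐ z : ℝ, Tendsto (fun ε : ℝ => cauchyOp h ((z : ℂ) - ε * Complex.I)) (𝓝[>] 0) (𝓝 (g z))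

/-- Square-integrable row vectors on the line, with the norm `(∫ |f₁|² + |f₂|²)^{1/2}`. -/
abbrev RowL2 : Type := Lp (EuclideanSpace ℂ (Fin 2)) 2 (volume : Measure ℝ)

/-- `2 × 2` matrices of square-integrable functions on the line. -/
abbrev MatL2 : Type := Matrix (Fin 2) (Fin 2) (Lp ℂ 2 (volume : Measure ℝ))

/-- The value at `z` of a matrix-valued function. -/
def MatL2.val (G : MatL2) (z : ℝ) : Matrix (Fin 2) (Fin 2) ℂ :=
  Matrix.of fun i j => G i j z

/-- `κ` parametrizes the contour by `z = k²`: it picks a square root of every real `z`,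
real for `z ≥ 0` and imaginary for `z < 0`. -/
def IsBranch (κ : ℝ → ℂ) : Prop := ∀ z : ℝ, κ z ^ 2 = (z : ℂ)

/-- `r ∈ L²_z ∩ L^∞_z` and `1 - |r(k)|² ≥ c₀²` for (almost all) `k ∈ iℝ`. -/
structure IsReflection (κ : ℝ → ℂ) (r : ℂ → ℂ) (c₀ : ℝ) : Prop where
  memLp_two : MemLp (fun z => r (κ z)) 2 (volume : Measure ℝ)
  memLp_top : MemLp (fun z => r (κ z)) ⊤ (volume : Measure ℝ)
  gap : ∀ᵐ z : ℝ, z < 0 → c₀ ^ 2 ≤ 1 - ‖r (κ z)‖ ^ 2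

/-- The Fredholm equation `G = 𝒫⁻(G J) + 𝒫⁻(J)`, entry by entry and almost everywhere in `z`. -/
def SolvesFredholm (J : ℝ → Matrix (Fin 2) (Fin 2) ℂ) (G : MatL2) : Prop :=
  ∃ A B : ℝ → Matrix (Fin 2) (Fin 2) ℂ,
    (∀ i j, IsPlemeljMinus (fun z => (G.val z * J z) i j) (fun z => A z i j)) ∧
    (∀ i j, IsPlemeljMinus (fun z => J z i j) (fun z => B z i j)) ∧
    ∀ᵐ z : ℝ, G.val z = A z + B z

/-- `T` is the operator `f ↦ f - 𝒫⁻(f J)` on row vectors. -/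
def IsFredholmOp (J : ℝ → Matrix (Fin 2) (Fin 2) ℂ) (T : RowL2 → RowL2) : Prop :=
  ∀ f : RowL2, ∃ A : ℝ → Fin 2 → ℂ,
    (∀ j, IsPlemeljMinus (fun z => Matrix.vecMul (fun i => f z i) (J z) j) (fun z => A z j)) ∧
    ∀ᵐ z : ℝ, ∀ j, T f z j = f z j - A z j

end

/-! On `L²` the boundary operator `𝒫⁻` is `-Π`, with `Π` the orthogonal projection onto the Hardy
space of the lower half-plane. With `V = 1 + J` acting by right multiplication, `f - 𝒫⁻(fJ) = f +
Π(fJ) = (1 - Π)f + Π(fV)`, a Toeplitz-type operator.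

The matrix `V` has uniformly positive real part. On the real part of the contour it is Hermitian
with quadratic form `|a₀|² + |a₀ q̄ + a₁|²`; on the imaginary part its off-diagonal is skew, leaving
`(1 - |q|²)|a₀|² + |a₁|²`. Since `q` is `r` times a unimodular factor, the lower bound does not
depend on `x`. Coercivity of the compression `S = (1 - Π) + ΠVΠ` makes `S` invertible by
Lax–Milgram, and `1 + ΠJ = (1 + N)S` with `N = ΠV(1 - Π)`, `N² = 0`
(`exists_equiv_add_starProjection`). The matrix equation is then solved row by row with right-hand
side `𝒫⁻(J)`.

The identity `𝒫⁻ = -Π` (`isPlemeljMinus_inner_starProjection`) holds pointwise almost everywhere: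
the Cauchy integral of `f` at `z - iε` is minus the Poisson integral of `Πf`, which converges at
Lebesgue points. -/

/-! ### Poisson integrals and their almost everywhere boundary values -/

/-- The Poisson kernel of the half-plane. -/
noncomputable def poissonLine (ε t : ℝ) : ℝ := Real.pi⁻¹ * (ε / (t ^ 2 + ε ^ 2))

theorem poissonLine_eq {ε : ℝ} (hε : 0 < ε) (t : ℝ) :
    poissonLine ε t = (Real.pi * ε)⁻¹ * (1 + (t / ε) ^ 2)⁻¹ := by
  have h : t ^ 2 + ε ^ 2 ≠ 0 := by positivity
  have h' : 1 + (t / ε) ^ 2 = (t ^ 2 + ε ^ 2) / ε ^ 2 := by field_simp; ring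
  rw [poissonLine, h']
  field_simp

theorem poissonLine_nonneg {ε : ℝ} (hε : 0 < ε) (t : ℝ) : 0 ≤ poissonLine ε t := by
  unfold poissonLine
  positivity

theorem measurable_poissonLine (ε : ℝ) : Measurable (poissonLine ε) := by
  unfold poissonLine
  fun_prop

theorem integrable_poissonLine {ε : ℝ} (hε : 0 < ε) : Integrable (poissonLine ε) := by
  have h := (integrable_inv_one_add_sq.comp_div hε.ne').const_mul (Real.pi * ε)⁻¹
  exact h.congr (ae_of_all _ fun t => (poissonLine_eq hε t).symm)

theorem integral_poissonLine {ε : ℝ} (hε : 0 < ε) : ∫ t, poissonLine ε t = 1 := by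
  simp_rw [poissonLine_eq hε]
  rw [integral_const_mul, Measure.integral_comp_div (fun t : ℝ => (1 + t ^ 2)⁻¹) ε,
    integral_univ_inv_one_add_sq, abs_of_pos hε, smul_eq_mul]
  have := Real.pi_pos
  field_simp

/-- Pointwise dyadic majorant of the Poisson kernel. -/
theorem poissonLine_le_dyadic {ε : ℝ} (hε : 0 < ε) (t : ℝ) :
    ∃ k : ℕ, |t| ≤ 2 ^ k * ε ∧ poissonLine ε t ≤ 4 / (4 ^ k * ε) := by
  have hpi : Real.pi⁻¹ ≤ 1 := inv_le_one_of_one_le₀ (by linarith [Real.pi_gt_three])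
  have h0 : 0 ≤ ε / (t ^ 2 + ε ^ 2) := by positivity
  have hp : poissonLine ε t ≤ ε / (t ^ 2 + ε ^ 2) := by
    unfold poissonLine
    nlinarith
  have hex : ∃ k : ℕ, |t| ≤ 2 ^ k * ε := by
    obtain ⟨k, hk⟩ := pow_unbounded_of_one_lt (|t| / ε) (one_lt_two : (1 : ℝ) < 2)
    exact ⟨k, ((div_lt_iff₀ hε).1 hk).le⟩
  classical
  -- The least admissible `k`: if it is positive, minimality gives `|t| > 2^(k-1) ε`, hence the
  -- decay `4^(-k)`.
  refine ⟨Nat.find hex, Nat.find_spec hex, hp.trans ?_⟩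
  rcases hk : Nat.find hex with _ | k
  · rw [div_le_div_iff₀ (by positivity) (by positivity)]
    nlinarith [sq_nonneg t]
  · have hlt : 2 ^ k * ε < |t| := not_le.1 (Nat.find_min hex (by omega))
    have hsq : (2 ^ k * ε) ^ 2 ≤ t ^ 2 := by
      rw [← sq_abs t]
      exact pow_le_pow_left₀ (by positivity) hlt.le 2
    have h4 : (2 ^ k : ℝ) ^ 2 = 4 ^ k := by rw [← pow_mul, mul_comm, pow_mul]; norm_num
    rw [mul_pow, h4] at hsq
    rw [div_le_div_iff₀ (by positivity) (by positivity), pow_succ]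
    nlinarith [sq_nonneg ε]

/-- The factor `8 · 2^(-k)` is the dyadic height `4 / (4^k ε)` times the length `2 · 2^k ε` of the
ball. -/
theorem integral_mul_poissonLine_le {φ : ℝ → ℝ} (hφ : LocallyIntegrable φ) (h0 : ∀ s, 0 ≤ φ s)
    (z : ℝ) {ε : ℝ} (hε : 0 < ε)
    (hs : Summable fun k : ℕ => 8 * (1 / 2) ^ k * ⨍ s in Metric.closedBall z (2 ^ k * ε), φ s) :
    ∫ s, φ s * poissonLine ε (s - z) ≤
      ∑' k : ℕ, 8 * (1 / 2) ^ k * ⨍ s in Metric.closedBall z (2 ^ k * ε), φ s := by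
  set a : ℕ → ℝ := fun k => 8 * (1 / 2) ^ k * ⨍ s in Metric.closedBall z (2 ^ k * ε), φ s
  have havg : ∀ k, 4 / (4 ^ k * ε) * ∫ s in Metric.closedBall z (2 ^ k * ε), φ s = a k := by
    intro k
    simp only [a]
    have h4 : (4 : ℝ) ^ k = 2 ^ k * 2 ^ k := by rw [← mul_pow]; norm_num
    rw [setAverage_eq, Measure.real, Real.volume_closedBall,
      ENNReal.toReal_ofReal (by positivity), smul_eq_mul, h4, one_div, inv_pow]
    field_simp
    ring
  have ha : ∀ k, 0 ≤ a k := by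
    intro k
    rw [← havg]
    have : 0 ≤ ∫ s in Metric.closedBall z (2 ^ k * ε), φ s := integral_nonneg fun s => h0 s
    positivity
  have hmeas : AEStronglyMeasurable (fun s => φ s * poissonLine ε (s - z)) :=
    hφ.aestronglyMeasurable.mul
      ((measurable_poissonLine ε).comp (measurable_id.sub_const z)).aestronglyMeasurable
  rw [integral_eq_lintegral_of_nonneg_ae
    (ae_of_all _ fun s => mul_nonneg (h0 s) (poissonLine_nonneg hε _)) hmeas]
  refine ENNReal.toReal_le_of_le_ofReal (tsum_nonneg ha) ?_
  rw [ENNReal.ofReal_tsum_of_nonneg ha hs]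
  calc ∫⁻ s, ENNReal.ofReal (φ s * poissonLine ε (s - z))
      ≤ ∫⁻ s, ∑' k : ℕ, (Metric.closedBall z (2 ^ k * ε)).indicator
          (fun s => ENNReal.ofReal (4 / (4 ^ k * ε) * φ s)) s := by
        refine lintegral_mono fun s => ?_
        obtain ⟨k, hk, hle⟩ := poissonLine_le_dyadic hε (s - z)
        refine le_trans ?_ (ENNReal.le_tsum k)
        rw [Set.indicator_of_mem (by simpa [Real.dist_eq] using hk)]
        refine ENNReal.ofReal_le_ofReal ?_
        rw [mul_comm]
        exact mul_le_mul_of_nonneg_right hle (h0 s)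
    _ = ∑' k : ℕ, ∫⁻ s in Metric.closedBall z (2 ^ k * ε),
          ENNReal.ofReal (4 / (4 ^ k * ε) * φ s) := by
        rw [lintegral_tsum fun k => (((hφ.aestronglyMeasurable.aemeasurable.const_mul
          _).ennreal_ofReal).indicator Metric.isClosed_closedBall.measurableSet)]
        simp_rw [lintegral_indicator Metric.isClosed_closedBall.measurableSet]
    _ = ∑' k, ENNReal.ofReal (a k) := by
        congr 1
        ext k
        rw [← havg, ← integral_const_mul, ofReal_integral_eq_lintegral_ofReal]
        · exact (hφ.integrableOn_isCompact (isCompact_closedBall _ _)).const_mul _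
        · exact ae_of_all _ fun s => mul_nonneg (by positivity) (h0 s)

theorem integrable_mul_poissonLine {F : ℝ → ℂ} (hF : MemLp F 2) (z : ℝ) {ε : ℝ} (hε : 0 < ε) :
    Integrable fun s => F s * (poissonLine ε (s - z) : ℂ) := by
  have hP : Integrable fun s => poissonLine ε (s - z) :=
    (integrable_poissonLine hε).comp_sub_right z
  have hF2 : Integrable fun s => ‖F s‖ ^ 2 := (memLp_two_iff_integrable_sq_norm hF.1).1 hF
  refine (hP.add (hF2.const_mul (Real.pi * ε)⁻¹)).mono' (hF.1.mul
    (Complex.continuous_ofReal.comp_aestronglyMeasurable hP.1)) (ae_of_all _ fun s => ?_)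
  have h0 := poissonLine_nonneg hε (s - z)
  have h1 : poissonLine ε (s - z) ≤ (Real.pi * ε)⁻¹ := by
    rw [poissonLine_eq hε]
    have := Real.pi_pos
    exact mul_le_of_le_one_right (by positivity)
      (inv_le_one_of_one_le₀ (by nlinarith [sq_nonneg ((s - z) / ε)]))
  simp only [norm_mul, Complex.norm_real, Real.norm_of_nonneg h0, Pi.add_apply]
  nlinarith [mul_le_mul_of_nonneg_right h1 (sq_nonneg ‖F s‖), sq_nonneg (‖F s‖ - 1)]

/-- At a Lebesgue point each dyadic average of `‖F - F z‖` tends to `0`; a bound on the averages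
over all radii permits dominated convergence in the dyadic sum. -/
theorem ae_tendsto_integral_poissonLine {F : ℝ → ℂ} (hF : MemLp F 2) :
    ∀ᵐ z : ℝ, Tendsto (fun ε : ℝ => ∫ s, F s * (poissonLine ε (s - z) : ℂ)) (𝓝[>] 0)
      (𝓝 (F z)) := by
  have hloc : LocallyIntegrable F := hF.locallyIntegrable (by norm_num)
  have hF2 : Integrable fun s => ‖F s‖ ^ 2 := (memLp_two_iff_integrable_sq_norm hF.1).1 hF
  filter_upwards [IsUnifLocDoublingMeasure.ae_tendsto_average_norm_sub.{0, 0, 0} volume hloc 1]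
    with z hz
  set φ : ℝ → ℝ := fun s => ‖F s - F z‖
  have hφ : LocallyIntegrable φ := fun s =>
    ((hloc.sub (locallyIntegrable_const (F z))) s).norm
  have h0 : ∀ s, 0 ≤ φ s := fun s => norm_nonneg _
  set A : ℝ → ℝ := fun u => ⨍ s in Metric.closedBall z u, φ s
  have hA0 : ∀ u, 0 ≤ A u := fun u => integral_nonneg fun s => h0 s
  have hA : Tendsto A (𝓝[>] 0) (𝓝 0) := by
    refine hz (fun _ => z) id tendsto_id ?_
    filter_upwards [self_mem_nhdsWithin] with u hu
    simpa using (Set.mem_Ioi.1 hu).le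
  -- Small radii are controlled by the Lebesgue point property, large ones by the `L²` norm through
  -- `‖F‖ ≤ 1 + ‖F‖²`.
  obtain ⟨C, hC⟩ : ∃ C, ∀ u, 0 < u → A u ≤ C := by
    obtain ⟨δ, hδ, hδA⟩ := mem_nhdsGT_iff_exists_Ioo_subset.1 (hA.eventually (gt_mem_nhds one_pos))
    replace hδ : 0 < δ := hδ
    set I := ∫ s, ‖F s‖ ^ 2
    have hI : 0 ≤ I := integral_nonneg fun s => by positivity
    refine ⟨1 + ‖F z‖ + (2 * δ)⁻¹ * I, fun u hu => ?_⟩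
    have hδ' : 0 ≤ (2 * δ)⁻¹ * I := by positivity
    rcases lt_or_ge u δ with h | h
    · have : A u < 1 := hδA ⟨hu, h⟩
      linarith [norm_nonneg (F z)]
    · have hvol : volume.real (Metric.closedBall z u) = 2 * u := by
        rw [Measure.real, Real.volume_closedBall, ENNReal.toReal_ofReal (by positivity)]
      simp only [A]
      rw [setAverage_eq, hvol, smul_eq_mul]
      have hconst : IntegrableOn (fun _ : ℝ => 1 + ‖F z‖) (Metric.closedBall z u) :=
        continuous_const.continuousOn.integrableOn_compact (isCompact_closedBall _ _)
      have hle : ∫ s in Metric.closedBall z u, φ s ≤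
          ∫ s in Metric.closedBall z u, ((1 + ‖F z‖) + ‖F s‖ ^ 2) := by
        refine setIntegral_mono (hφ.integrableOn_isCompact (isCompact_closedBall _ _)) ?_ ?_
        · exact hconst.add hF2.integrableOn
        · intro s
          have := norm_sub_le (F s) (F z)
          simp only [φ]
          nlinarith [sq_nonneg (‖F s‖ - 1)]
      have hle2 : ∫ s in Metric.closedBall z u, ((1 + ‖F z‖) + ‖F s‖ ^ 2) ≤
          2 * u * (1 + ‖F z‖) + I := by
        rw [integral_add hconst hF2.integrableOn,
          setIntegral_const, hvol, smul_eq_mul]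
        gcongr
        exact setIntegral_le_integral hF2 (ae_of_all _ fun s => by positivity)
      calc (2 * u)⁻¹ * ∫ s in Metric.closedBall z u, φ s
          ≤ (2 * u)⁻¹ * (2 * u * (1 + ‖F z‖) + I) := by gcongr; exact hle.trans hle2
        _ = (1 + ‖F z‖) + (2 * u)⁻¹ * I := by field_simp
        _ ≤ _ := by gcongr
  have hgeo : Summable fun k : ℕ => 8 * (1 / 2 : ℝ) ^ k * C :=
    (summable_geometric_two.mul_left 8).mul_right C
  have hterm : ∀ (ε : ℝ), 0 < ε → ∀ k : ℕ,
      ‖8 * (1 / 2 : ℝ) ^ k * A (2 ^ k * ε)‖ ≤ 8 * (1 / 2 : ℝ) ^ k * C := by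
    intro ε hε k
    rw [Real.norm_of_nonneg (mul_nonneg (by positivity) (hA0 _))]
    exact mul_le_mul_of_nonneg_left (hC _ (by positivity)) (by positivity)
  have hsum : Tendsto (fun ε : ℝ => ∑' k : ℕ, 8 * (1 / 2 : ℝ) ^ k * A (2 ^ k * ε)) (𝓝[>] 0)
      (𝓝 0) := by
    have h := tendsto_tsum_of_dominated_convergence (𝓕 := 𝓝[>] (0 : ℝ))
      (f := fun ε k => 8 * (1 / 2 : ℝ) ^ k * A (2 ^ k * ε)) (g := fun _ => (0 : ℝ)) hgeo ?_ ?_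
    · simpa using h
    · intro k
      have hk : Tendsto (fun ε : ℝ => (2 : ℝ) ^ k * ε) (𝓝[>] 0) (𝓝[>] 0) := by
        refine tendsto_nhdsWithin_iff.2 ⟨?_, ?_⟩
        · have : Tendsto (fun ε : ℝ => 2 ^ k * ε) (𝓝 0) (𝓝 (2 ^ k * 0)) :=
            (continuous_const_mul _).tendsto _
          rw [mul_zero] at this
          exact this.mono_left nhdsWithin_le_nhds
        · filter_upwards [self_mem_nhdsWithin] with ε hε
          exact mul_pos (pow_pos two_pos k) (Set.mem_Ioi.1 hε)
      have h := (hA.comp hk).const_mul (8 * (1 / 2 : ℝ) ^ k)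
      rwa [mul_zero] at h
    · filter_upwards [self_mem_nhdsWithin] with ε hε using hterm ε hε
  rw [tendsto_iff_norm_sub_tendsto_zero]
  refine squeeze_zero' (Eventually.of_forall fun _ => norm_nonneg _) ?_ hsum
  filter_upwards [self_mem_nhdsWithin] with ε hε
  replace hε : 0 < ε := hε
  have hP : Integrable fun s => poissonLine ε (s - z) :=
    (integrable_poissonLine hε).comp_sub_right z
  have hone : ∫ s, F z * (poissonLine ε (s - z) : ℂ) = F z := by
    rw [integral_const_mul, integral_complex_ofReal,
      integral_sub_right_eq_self (poissonLine ε) z, integral_poissonLine hε]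
    simp
  have heq : (∫ s, F s * (poissonLine ε (s - z) : ℂ)) - F z =
      ∫ s, (F s - F z) * (poissonLine ε (s - z) : ℂ) := by
    conv_lhs => rw [← hone]
    have hPc : Integrable fun s => F z * (poissonLine ε (s - z) : ℂ) :=
      (hP.ofReal (𝕜 := ℂ)).const_mul (F z)
    rw [← integral_sub (integrable_mul_poissonLine hF z hε) hPc]
    simp_rw [sub_mul]
  rw [heq]
  refine (norm_integral_le_integral_norm _).trans ?_
  have hnorm : ∀ s, ‖(F s - F z) * (poissonLine ε (s - z) : ℂ)‖ = φ s * poissonLine ε (s - z) :=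
    fun s => by
      rw [norm_mul, Complex.norm_real, Real.norm_of_nonneg (poissonLine_nonneg hε _)]
  simp_rw [hnorm]
  exact integral_mul_poissonLine_le hφ h0 z hε (hgeo.of_norm_bounded (hterm ε hε))

/-! ### Hardy projection and the Plemelj operator -/

section Hardy

variable {E : Type*} [NormedAddCommGroup E] [InnerProductSpace ℂ E]

theorem ofReal_sub_ne_zero {w : ℂ} (hw : w.im ≠ 0) (s : ℝ) : (s : ℂ) - w ≠ 0 := by
  intro h
  apply hw
  have := congrArg Complex.im h
  simpa using this

theorem memLp_inv_sub {w : ℂ} (hw : w.im ≠ 0) :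
    MemLp (fun s : ℝ => ((s : ℂ) - w)⁻¹) 2 := by
  have hm : Measurable (fun s : ℝ => ((s : ℂ) - w)⁻¹) := by fun_prop
  rw [memLp_two_iff_integrable_sq_norm hm.aestronglyMeasurable]
  have h := ((integrable_poissonLine (abs_pos.2 hw)).comp_sub_right w.re).const_mul
    (Real.pi / |w.im|)
  refine h.congr (ae_of_all _ fun s => ?_)
  have hw' : |w.im| ≠ 0 := abs_ne_zero.2 hw
  have hpi := Real.pi_pos.ne'
  have : ‖(s : ℂ) - w‖ ^ 2 = (s - w.re) ^ 2 + w.im ^ 2 := by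
    rw [← Complex.normSq_eq_norm_sq, Complex.normSq_apply]
    simp
    ring
  simp only [norm_inv, inv_pow]
  rw [this, poissonLine, sq_abs]
  field_simp

theorem integrable_inv_sub_mul_inv_sub {a b : ℂ} (ha : a.im ≠ 0) (hb : b.im ≠ 0) :
    Integrable fun s : ℝ => ((s : ℂ) - a)⁻¹ * ((s : ℂ) - b)⁻¹ :=
  (memLp_inv_sub ha).integrable_mul (memLp_inv_sub hb)

theorem tendsto_inv_ofReal_sub_cobounded (b : ℂ) :
    Tendsto (fun s : ℝ => ((s : ℂ) - b)⁻¹) (Bornology.cobounded ℝ) (𝓝 0) := by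
  refine tendsto_inv₀_cobounded.comp ?_
  have h1 : Tendsto (fun s : ℝ => (s : ℂ)) (Bornology.cobounded ℝ) (Bornology.cobounded ℂ) := by
    rw [← tendsto_norm_atTop_iff_cobounded]
    simp only [Complex.norm_real]
    exact tendsto_norm_cobounded_atTop
  rw [← tendsto_norm_atTop_iff_cobounded] at h1 ⊢
  refine tendsto_atTop_mono (fun s => ?_) (tendsto_atTop_add_const_right _ (-‖b‖) h1)
  have := norm_sub_norm_le (s : ℂ) b
  linarith

/-- Two poles in the lower half-plane: the contour can be closed in the upper one. -/
theorem integral_inv_sub_mul_inv_sub {a b : ℂ} (ha : a.im < 0) (hb : b.im < 0) :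
    ∫ s : ℝ, ((s : ℂ) - a)⁻¹ * ((s : ℂ) - b)⁻¹ = 0 := by
  have hint := integrable_inv_sub_mul_inv_sub ha.ne hb.ne
  have key : ∀ f : ℝ → ℂ, (∀ s : ℝ, HasDerivAt f (((s : ℂ) - a)⁻¹ * ((s : ℂ) - b)⁻¹) s) →
      Tendsto f (Bornology.cobounded ℝ) (𝓝 0) →
      ∫ s : ℝ, ((s : ℂ) - a)⁻¹ * ((s : ℂ) - b)⁻¹ = 0 := by
    intro f hf hlim
    rw [IsOrderBornology.cobounded_eq, tendsto_sup] at hlim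
    simpa using integral_of_hasDerivAt_of_tendsto hf hint hlim.1 hlim.2
  have hd : ∀ (c : ℂ) (s : ℝ), HasDerivAt (fun s : ℝ => (s : ℂ) - c) 1 s := fun c s =>
    (Complex.ofRealCLM.hasDerivAt (x := s)).sub_const c
  rcases eq_or_ne a b with rfl | hab
  · refine key (fun s => -((s : ℂ) - a)⁻¹) (fun s => ?_) ?_
    · have hs := ofReal_sub_ne_zero ha.ne s
      refine ((hd a s).inv hs).neg.congr_deriv ?_
      field_simp
    · simpa using (tendsto_inv_ofReal_sub_cobounded a).neg
  · have hab' : a - b ≠ 0 := sub_ne_zero.2 hab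
    refine key (fun s => (a - b)⁻¹ * Complex.log (((s : ℂ) - a) / ((s : ℂ) - b)))
      (fun s => ?_) ?_
    · have hsa := ofReal_sub_ne_zero ha.ne s
      have hsb := ofReal_sub_ne_zero hb.ne s
      -- `s - a` and `s - b` both have positive imaginary part, so their quotient is never a
      -- nonpositive real and the principal logarithm is a global antiderivative.
      have hslit : ((s : ℂ) - a) / ((s : ℂ) - b) ∈ Complex.slitPlane := by
        rw [Complex.mem_slitPlane_iff_not_le_zero]
        intro hle
        obtain ⟨hre, him⟩ := Complex.le_def.1 hle
        set q := ((s : ℂ) - a) / ((s : ℂ) - b) with hq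
        have hmul : (s : ℂ) - a = q * ((s : ℂ) - b) := by rw [hq, div_mul_cancel₀ _ hsb]
        have h := congrArg Complex.im hmul
        simp only [Complex.zero_re, Complex.zero_im] at hre him
        simp [him] at h
        nlinarith
      refine ((((hd a s).div (hd b s) hsb).clog_real hslit).const_mul (a - b)⁻¹).congr_deriv ?_
      simp only [Pi.div_apply]
      field_simp
      ring
    · have h1 : Tendsto (fun s : ℝ => 1 + (b - a) * ((s : ℂ) - b)⁻¹) (Bornology.cobounded ℝ)
          (𝓝 1) := by
        simpa using ((tendsto_inv_ofReal_sub_cobounded b).const_mul (b - a)).const_add 1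
      have h2 := (continuousAt_clog Complex.one_mem_slitPlane).tendsto.comp h1
      rw [Complex.log_one] at h2
      have h3 := h2.const_mul (a - b)⁻¹
      rw [mul_zero] at h3
      refine h3.congr fun s => ?_
      have hsb := ofReal_sub_ne_zero hb.ne s
      simp only [Function.comp]
      congr 2
      field_simp
      ring

/-- The Cauchy kernel with pole `w` and direction `v`. -/
noncomputable def cauchyKer {w : ℂ} (hw : w.im ≠ 0) (v : E) : Lp E 2 (volume : Measure ℝ) :=
  (((1 : ℂ →L[ℂ] ℂ).smulRight v).comp_memLp' (memLp_inv_sub hw)).toLp _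

theorem coeFn_cauchyKer {w : ℂ} (hw : w.im ≠ 0) (v : E) :
    cauchyKer hw v =ᵐ[volume] fun s : ℝ => ((s : ℂ) - w)⁻¹ • v :=
  MemLp.coeFn_toLp _

theorem inner_cauchyKer {w : ℂ} (hw : w.im ≠ 0) (v : E) (f : Lp E 2 (volume : Measure ℝ)) :
    inner ℂ (cauchyKer hw v) f =
      ∫ s : ℝ, ((s : ℂ) - starRingEnd ℂ w)⁻¹ * inner ℂ v (f s) := by
  rw [L2.inner_def]
  refine integral_congr_ae ?_
  filter_upwards [coeFn_cauchyKer hw v] with s hs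
  rw [hs, inner_smul_left]
  simp

variable (E) in
/-- The Hardy space of the lower half-plane, as the closed span of the Cauchy kernels with pole
in the upper half-plane. -/
noncomputable def lowerHardy : Submodule ℂ (Lp E 2 (volume : Measure ℝ)) :=
  (Submodule.span ℂ {g | ∃ (w : ℂ) (hw : 0 < w.im) (v : E),
    cauchyKer hw.ne' v = g}).topologicalClosure

variable [CompleteSpace E]

instance : (lowerHardy E).HasOrthogonalProjection := by
  unfold lowerHardy
  infer_instance

theorem starProjection_cauchyKer_of_pos {w : ℂ} (hw : 0 < w.im) (v : E) :
    (lowerHardy E).starProjection (cauchyKer hw.ne' v) = cauchyKer hw.ne' v :=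
  Submodule.starProjection_eq_self_iff.2 <| Submodule.le_topologicalClosure _ <|
    Submodule.subset_span ⟨w, hw, v, rfl⟩

/-- Conjugation in the inner product moves the pole of a generator of `lowerHardy` to the lower
half-plane, where `w` already lies, so the integral vanishes. -/
theorem starProjection_cauchyKer_of_neg {w : ℂ} (hw : w.im < 0) (v : E) :
    (lowerHardy E).starProjection (cauchyKer hw.ne v) = 0 := by
  rw [Submodule.starProjection_apply_eq_zero_iff, lowerHardy, Submodule.orthogonal_closure,
    Submodule.mem_orthogonal']
  intro u hu
  induction hu using Submodule.span_induction with
  | zero => simp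
  | add x y _ _ hx hy => rw [inner_add_right, hx, hy, add_zero]
  | smul c x _ hx => rw [inner_smul_right, hx, mul_zero]
  | mem u hu =>
    obtain ⟨w', hw', v', rfl⟩ := hu
    rw [← inner_conj_symm]
    rw [inner_cauchyKer]
    have : ∫ s : ℝ, ((s : ℂ) - starRingEnd ℂ w')⁻¹ * inner ℂ v' (cauchyKer hw.ne v s) =
        ∫ s : ℝ, ((s : ℂ) - starRingEnd ℂ w')⁻¹ * ((s : ℂ) - w)⁻¹ * inner ℂ v' v := by
      refine integral_congr_ae ?_
      filter_upwards [coeFn_cauchyKer hw.ne v] with s hs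
      rw [hs, inner_smul_right, mul_assoc]
    rw [this, integral_mul_const, integral_inv_sub_mul_inv_sub (by simpa using hw') hw]
    simp

/-- The Poisson kernel is a multiple of the difference of the Cauchy kernels with poles `z ± iε`.
Moving the self-adjoint projection onto the kernels keeps the upper pole and kills the lower one. -/
theorem integral_starProjection_mul_poissonLine (f : Lp E 2 (volume : Measure ℝ)) (v : E) (z : ℝ)
    {ε : ℝ} (hε : 0 < ε) :
    ∫ s, inner ℂ v ((lowerHardy E).starProjection f s) * (poissonLine ε (s - z) : ℂ) =
      -cauchyOp (fun s => inner ℂ v (f s)) ((z : ℂ) - ε * Complex.I) := by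
  set p : Lp E 2 (volume : Measure ℝ) := (lowerHardy E).starProjection f
  set w : ℂ := z + ε * Complex.I
  set w' : ℂ := z - ε * Complex.I
  have hw : 0 < w.im := by simpa [w] using hε
  have hw' : w'.im < 0 := by simpa [w'] using hε
  have hc : starRingEnd ℂ w = w' := by simp [w, w', sub_eq_add_neg]
  have hc' : starRingEnd ℂ w' = w := by simp [w, w']
  have h1 : inner ℂ (cauchyKer hw.ne' v - cauchyKer hw'.ne v) p =
      inner ℂ (cauchyKer hw.ne' v) f := by
    rw [← Submodule.inner_starProjection_left_eq_right, map_sub,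
      starProjection_cauchyKer_of_pos hw, starProjection_cauchyKer_of_neg hw', sub_zero]
  rw [inner_sub_left, inner_cauchyKer, inner_cauchyKer, inner_cauchyKer, hc, hc'] at h1
  have hint : ∀ {c : ℂ}, c.im ≠ 0 → Integrable fun s : ℝ => ((s : ℂ) - c)⁻¹ * inner ℂ v (p s) :=
    fun hc => (memLp_inv_sub hc).integrable_mul ((Lp.memLp p).const_inner v)
  rw [← integral_sub (hint hw'.ne) (hint hw.ne')] at h1
  have hker : ∀ s : ℝ, inner ℂ v (p s) * (poissonLine ε (s - z) : ℂ) =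
      -(2 * Real.pi * Complex.I)⁻¹ * (((s : ℂ) - w')⁻¹ * inner ℂ v (p s) -
        ((s : ℂ) - w)⁻¹ * inner ℂ v (p s)) := by
    intro s
    have h1 := ofReal_sub_ne_zero hw.ne' s
    have h2 := ofReal_sub_ne_zero hw'.ne s
    have hprod : ((s : ℂ) - w) * ((s : ℂ) - w') = ((s : ℂ) - z) ^ 2 + ε ^ 2 := by
      simp only [w, w']
      linear_combination (-(ε : ℂ) ^ 2) * Complex.I_sq
    have hdiff : ((s : ℂ) - w')⁻¹ - ((s : ℂ) - w)⁻¹ =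
        -(2 * ε * Complex.I) / (((s : ℂ) - z) ^ 2 + ε ^ 2) := by
      rw [← hprod]
      field_simp
      simp only [w, w']
      ring
    rw [← sub_mul, hdiff, poissonLine]
    push_cast
    have hpi : (Real.pi : ℂ) ≠ 0 := by exact_mod_cast Real.pi_pos.ne'
    have hden : ((s : ℂ) - z) ^ 2 + ε ^ 2 ≠ 0 := hprod ▸ mul_ne_zero h1 h2
    field_simp
  simp_rw [hker]
  rw [integral_const_mul, h1, cauchyOp, neg_mul]
  simp_rw [div_eq_inv_mul]

/-- The Plemelj operator `𝒫⁻` is minus the orthogonal projection onto the lower Hardy space. -/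
theorem isPlemeljMinus_inner_starProjection (f : Lp E 2 (volume : Measure ℝ)) (v : E) :
    IsPlemeljMinus (fun s => inner ℂ v (f s))
      (fun z => -inner ℂ v ((lowerHardy E).starProjection f z)) := by
  filter_upwards [ae_tendsto_integral_poissonLine
    ((Lp.memLp ((lowerHardy E).starProjection f)).const_inner v)] with z hz
  refine hz.neg.congr' ?_
  filter_upwards [self_mem_nhdsWithin] with ε hε
  rw [integral_starProjection_mul_poissonLine f v z hε, neg_neg]

theorem IsPlemeljMinus.congr_left {h h' g : ℝ → ℂ} (H : IsPlemeljMinus h g)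
    (hh : h =ᵐ[volume] h') : IsPlemeljMinus h' g := by
  filter_upwards [H] with z hz
  refine hz.congr fun ε => ?_
  simp only [cauchyOp]
  congr 1
  refine integral_congr_ae ?_
  filter_upwards [hh] with s hs
  rw [hs]

theorem IsPlemeljMinus.congr_right {h g g' : ℝ → ℂ} (H : IsPlemeljMinus h g)
    (hg : g =ᵐ[volume] g') : IsPlemeljMinus h g' := by
  filter_upwards [H, hg] with z hz hgz
  rwa [← hgz]

theorem IsPlemeljMinus.ae_unique {h g g' : ℝ → ℂ} (H : IsPlemeljMinus h g)
    (H' : IsPlemeljMinus h g') : g =ᵐ[volume] g' := by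
  filter_upwards [H, H'] with z hz hz'
  exact tendsto_nhds_unique hz hz'

theorem exists_isPlemeljMinus {h : ℝ → ℂ} (hh : MemLp h 2) :
    ∃ g : Lp ℂ 2 (volume : Measure ℝ), IsPlemeljMinus h g := by
  have H := isPlemeljMinus_inner_starProjection (hh.toLp h) (1 : ℂ)
  refine ⟨-(lowerHardy ℂ).starProjection (hh.toLp h), (H.congr_left ?_).congr_right ?_⟩
  · filter_upwards [hh.coeFn_toLp] with s hs
    simp [hs]
  · filter_upwards [Lp.coeFn_neg ((lowerHardy ℂ).starProjection (hh.toLp h))] with s hs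
    rw [hs]
    simp

end Hardy

/-! ### Inversion of Toeplitz-type operators with coercive symbol -/

section Abstract

variable {H : Type*} [NormedAddCommGroup H] [InnerProductSpace ℂ H] [CompleteSpace H]

/-- If `V` is coercive then the Toeplitz-type operator `(1 - P) + P V` is boundedly invertible, for
every orthogonal projection `P`. -/
theorem exists_equiv_add_starProjection (K : Submodule ℂ H) [K.HasOrthogonalProjection]
    (J : H →L[ℂ] H) {c : ℝ} (hc : 0 < c) (hc1 : c ≤ 1)
    (hJ : ∀ f, c * ‖f‖ ^ 2 ≤ (inner ℂ f (f + J f)).re) :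
    ∃ T : H ≃L[ℂ] H, (∀ f, T f = f + K.starProjection (J f)) ∧
      ∀ f, ‖T.symm f‖ ≤ c⁻¹ * (2 + ‖J‖) * ‖f‖ := by
  set P : H →L[ℂ] H := K.starProjection
  have hPP : ∀ f, P (P f) = P f := fun f =>
    Submodule.starProjection_eq_self_iff.2 (K.starProjection_apply_mem f)
  have hPn : ∀ f, ‖P f‖ ≤ ‖f‖ := fun f => K.norm_starProjection_apply_le f
  have hQn : ∀ f, ‖f - P f‖ ≤ ‖f‖ := fun f => by
    have h := Kᗮ.norm_starProjection_apply_le f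
    rwa [Submodule.starProjection_orthogonal'] at h
  have hsa : ∀ f g, inner ℂ (P f) g = inner ℂ f (P g) :=
    fun f g => K.inner_starProjection_left_eq_right f g
  set V : H →L[ℂ] H := 1 + J
  set S : H →L[ℂ] H := (1 - P) + P * V * P
  set N : H →L[ℂ] H := P * V * (1 - P)
  have hS : ∀ f, c * ‖f‖ ^ 2 ≤ (inner ℂ f (S f)).re := by
    intro f
    have h1 : inner ℂ f (S f) = inner ℂ (f - P f) (f - P f) + inner ℂ (P f) (P f + J (P f)) := by
      have e1 : S f = (f - P f) + P (P f + J (P f)) := by simp [S, V]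
      rw [e1, inner_add_right, ← hsa f]
      congr 1
      rw [inner_sub_left f, hsa f, map_sub, hPP, sub_self, inner_zero_right, sub_zero]
    have h2 : ‖f‖ ^ 2 = ‖f - P f‖ ^ 2 + ‖P f‖ ^ 2 := by
      have h3 : inner ℂ (f - P f) (P f) = 0 := by
        rw [← hsa, map_sub, hPP, sub_self, inner_zero_left]
      have h4 := norm_add_sq_eq_norm_sq_add_norm_sq_of_inner_eq_zero (f - P f) (P f) h3
      rw [sub_add_cancel] at h4
      nlinarith
    rw [h1, h2, Complex.add_re, inner_self_eq_norm_sq_to_K]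
    have h5 := hJ (P f)
    have h6 : (((‖f - P f‖ : ℝ) : ℂ) ^ 2).re = ‖f - P f‖ ^ 2 := by norm_cast
    have h7 : (((‖f - P f‖ : ℝ) : ℂ) ^ 2).re + (inner ℂ (P f) (P f + J (P f))).re ≥
      c * (‖f - P f‖ ^ 2 + ‖P f‖ ^ 2) := by rw [h6]; nlinarith [sq_nonneg ‖f - P f‖]
    exact h7
  have hSle : ∀ f, ‖f‖ ≤ c⁻¹ * ‖S f‖ := by
    intro f
    rcases eq_or_ne f 0 with rfl | hf
    · simp
    have h0 : 0 < ‖f‖ := norm_pos_iff.2 hf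
    have h1 : c * ‖f‖ ^ 2 ≤ ‖f‖ * ‖S f‖ :=
      (hS f).trans ((Complex.re_le_norm _).trans (norm_inner_le_norm _ _))
    rw [← div_eq_inv_mul, le_div_iff₀ hc]
    nlinarith
  have hSu : IsUnit S := by
    -- Lax–Milgram.
    refine ContinuousLinearMap.isUnit_of_forall_le_norm_inner_map S (c := ⟨c, hc.le⟩) hc fun f => ?_
    rw [norm_inner_symm]
    calc ‖f‖ ^ 2 * c = c * ‖f‖ ^ 2 := mul_comm _ _
      _ ≤ _ := (hS f).trans (Complex.re_le_norm _)
  have hPmul : P * P = P := ContinuousLinearMap.ext hPP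
  have hNN : N * N = 0 := by
    have : (1 - P) * P = 0 := by rw [sub_mul, one_mul, hPmul, sub_self]
    calc N * N = P * V * ((1 - P) * P) * V * (1 - P) := by simp only [N, mul_assoc]
      _ = 0 := by rw [this]; simp
  have hNu : IsUnit (1 + N) :=
    IsNilpotent.isUnit_one_add ⟨2, by rw [pow_two, hNN]⟩
  -- Because `NS = N`, the product is `(1 - P) + PVP + PV(1 - P) = (1 - P) + PV`.
  have hT : (1 + N) * S = 1 + P * J := by
    have e1 : (1 - P) * (1 - P) = 1 - P := by
      rw [sub_mul, one_mul, mul_sub, mul_one, hPmul, sub_self, sub_zero]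
    have e2 : (1 - P) * P = 0 := by rw [sub_mul, one_mul, hPmul, sub_self]
    have e3 : N * S = P * V * (1 - P) := by
      calc N * S = P * V * ((1 - P) * (1 - P)) + P * V * ((1 - P) * P) * V * P := by
            simp only [N, S, mul_add, mul_assoc]
        _ = _ := by rw [e1, e2]; simp
    rw [add_mul, one_mul, e3]
    simp only [S, V]
    noncomm_ring
  obtain ⟨u, hu⟩ := hNu.mul hSu
  refine ⟨ContinuousLinearEquiv.unitsEquiv ℂ H u, fun f => ?_, fun g => ?_⟩
  · rw [ContinuousLinearEquiv.unitsEquiv_apply, hu, hT]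
    simp
  · obtain ⟨f, rfl⟩ := (ContinuousLinearEquiv.unitsEquiv ℂ H u).surjective g
    rw [ContinuousLinearEquiv.symm_apply_apply, ContinuousLinearEquiv.unitsEquiv_apply, hu]
    set g := ((1 + N) * S) f with hg
    -- The inverse of `1 + N` is `1 - N`; this gives the norm bound without computing the inverse of
    -- the product.
    have h1 : S f = g - N g := by
      have : (1 - N) * ((1 + N) * S) = S := by
        rw [← mul_assoc]
        have : (1 - N) * (1 + N) = 1 := by
          rw [sub_mul, one_mul, mul_add, mul_one, hNN]; simp
        rw [this, one_mul]
      calc S f = ((1 - N) * ((1 + N) * S)) f := by rw [this]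
        _ = g - N g := by simp [hg]
    have h2 : ‖N g‖ ≤ (1 + ‖J‖) * ‖g‖ := by
      have e : N g = P ((g - P g) + J (g - P g)) := by simp [N, V]
      rw [e]
      refine (hPn _).trans ((norm_add_le _ _).trans ?_)
      have := J.le_opNorm (g - P g)
      have := hQn g
      nlinarith [norm_nonneg J]
    have h3 := norm_sub_le g (N g)
    calc ‖f‖ ≤ c⁻¹ * ‖S f‖ := hSle f
      _ ≤ c⁻¹ * ((2 + ‖J‖) * ‖g‖) := by
        gcongr
        rw [h1]
        linarith
      _ = _ := by ring

end Abstract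

/-! ### Multiplication by matrix functions on row vectors -/

section Multiplication

variable {E : Type*} [NormedAddCommGroup E] [InnerProductSpace ℂ E]

theorem exists_multiplication_operator {A : ℝ → E →L[ℂ] E}
    (hA : AEStronglyMeasurable A) {B : ℝ} (hB : 0 ≤ B) (hAB : ∀ᵐ z, ‖A z‖ ≤ B) :
    ∃ L : Lp E 2 (volume : Measure ℝ) →L[ℂ] Lp E 2 (volume : Measure ℝ),
      ‖L‖ ≤ B ∧ ∀ f, L f =ᵐ[volume] fun z => A z (f z) := by
  have hm : MemLp A ⊤ := memLp_top_of_bound hA B hAB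
  refine ⟨(ContinuousLinearMap.id ℂ (E →L[ℂ] E)).holderL volume ⊤ 2 2 (hm.toLp A), ?_, fun f => ?_⟩
  · refine ContinuousLinearMap.opNorm_le_bound _ hB fun f => ?_
    have h1 := (ContinuousLinearMap.id ℂ (E →L[ℂ] E)).norm_holder_apply_apply_le (r := 2)
      (hm.toLp A) f
    have h2 : ‖hm.toLp A‖ ≤ B := by
      rw [Lp.norm_toLp]
      refine ENNReal.toReal_le_of_le_ofReal hB ?_
      rw [eLpNorm_exponent_top]
      exact eLpNormEssSup_le_of_ae_bound hAB
    refine h1.trans ?_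
    have h3 : ‖ContinuousLinearMap.id ℂ (E →L[ℂ] E)‖ ≤ 1 := ContinuousLinearMap.norm_id_le
    calc _ ≤ 1 * B * ‖f‖ := by gcongr
      _ = _ := by ring
  · refine ((ContinuousLinearMap.id ℂ (E →L[ℂ] E)).coeFn_holder (r := 2) (hm.toLp A) f).trans ?_
    filter_upwards [hm.coeFn_toLp] with z hz
    simp [hz]

theorem le_re_inner_of_ae_le (f g : Lp E 2 (volume : Measure ℝ)) {c : ℝ}
    (h : ∀ᵐ z, c * ‖f z‖ ^ 2 ≤ (inner ℂ (f z) (g z)).re) :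
    c * ‖f‖ ^ 2 ≤ (inner ℂ f g).re := by
  have h1 : ‖f‖ ^ 2 = ∫ z, ‖f z‖ ^ 2 := by
    have := L2.inner_def (𝕜 := ℂ) f f
    rw [inner_self_eq_norm_sq_to_K] at this
    simp_rw [inner_self_eq_norm_sq_to_K] at this
    have h2 : ((‖f‖ ^ 2 : ℝ) : ℂ) = ((∫ z, ‖f z‖ ^ 2 : ℝ) : ℂ) := by
      rw [← integral_complex_ofReal]
      push_cast
      exact this
    exact_mod_cast h2
  have hint : Integrable fun z => ‖f z‖ ^ 2 :=
    (memLp_two_iff_integrable_sq_norm (Lp.memLp f).1).1 (Lp.memLp f)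
  have hint2 := L2.integrable_inner (𝕜 := ℂ) f g
  rw [h1, L2.inner_def, ← integral_const_mul]
  refine le_trans (integral_mono_ae (hint.const_mul c) hint2.re h) (le_of_eq ?_)
  exact integral_re hint2

/-- Right multiplication of row vectors by a matrix. -/
noncomputable def rowMul (M : Matrix (Fin 2) (Fin 2) ℂ) :
    EuclideanSpace ℂ (Fin 2) →L[ℂ] EuclideanSpace ℂ (Fin 2) :=
  Matrix.toEuclideanCLM (n := Fin 2) (𝕜 := ℂ) M.transpose

theorem rowMul_apply (M : Matrix (Fin 2) (Fin 2) ℂ) (a : EuclideanSpace ℂ (Fin 2)) (j : Fin 2) :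
    rowMul M a j = Matrix.vecMul (fun i => a i) M j := by
  rw [rowMul, Matrix.ofLp_toEuclideanCLM, Matrix.mulVec_transpose]

/-- Expanding in matrix units reduces both measurability and norm bounds to the scalar entries. -/
theorem rowMul_eq_sum (M : Matrix (Fin 2) (Fin 2) ℂ) :
    rowMul M = ∑ i, ∑ j, M i j • rowMul (Matrix.single i j 1) := by
  have h : M = ∑ i, ∑ j, M i j • Matrix.single i j (1 : ℂ) := by
    conv_lhs => rw [Matrix.matrix_eq_sum_single M]
    simp
  conv_lhs => rw [h]
  simp only [rowMul, Matrix.transpose_sum, Matrix.transpose_smul, map_sum, map_smul]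

/-- A bound for the norm of `rowMul` in terms of the largest entry. -/
noncomputable def rowMulBound : ℝ :=
  ∑ i : Fin 2, ∑ j : Fin 2, ‖rowMul (Matrix.single i j 1)‖

theorem rowMulBound_nonneg : 0 ≤ rowMulBound :=
  Finset.sum_nonneg fun _ _ => Finset.sum_nonneg fun _ _ => norm_nonneg _

theorem norm_rowMul_le {M : Matrix (Fin 2) (Fin 2) ℂ} {B : ℝ} (h : ∀ i j, ‖M i j‖ ≤ B) :
    ‖rowMul M‖ ≤ B * rowMulBound := by
  rw [rowMul_eq_sum, rowMulBound, Finset.mul_sum]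
  refine norm_sum_le_of_le _ fun i _ => ?_
  rw [Finset.mul_sum]
  refine norm_sum_le_of_le _ fun j _ => ?_
  rw [norm_smul]
  exact mul_le_mul_of_nonneg_right (h i j) (norm_nonneg _)

theorem aestronglyMeasurable_rowMul {M : ℝ → Matrix (Fin 2) (Fin 2) ℂ}
    (h : ∀ i j, AEStronglyMeasurable fun z => M z i j) :
    AEStronglyMeasurable fun z => rowMul (M z) := by
  simp_rw [rowMul_eq_sum (M _)]
  exact Finset.aestronglyMeasurable_fun_sum _ fun i _ =>
    Finset.aestronglyMeasurable_fun_sum _ fun j _ => (h i j).smul_const _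

theorem inner_single_one (a : EuclideanSpace ℂ (Fin 2)) (j : Fin 2) :
    inner ℂ (EuclideanSpace.single j (1 : ℂ)) a = a j := by
  simp [EuclideanSpace.inner_single_left]

/-- A bounded matrix function with coercive `1 + J` gives an invertible Fredholm operator. -/
theorem exists_fredholmOp {J : ℝ → Matrix (Fin 2) (Fin 2) ℂ}
    (hm : ∀ i j, AEStronglyMeasurable fun z => J z i j) {B c : ℝ} (hB : 0 ≤ B)
    (hb : ∀ᵐ z, ∀ i j, ‖J z i j‖ ≤ B) (hc : 0 < c) (hc1 : c ≤ 1)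
    (hJ : ∀ᵐ z, ∀ a : EuclideanSpace ℂ (Fin 2),
      c * ‖a‖ ^ 2 ≤ (inner ℂ a (a + rowMul (J z) a)).re) :
    ∃ T : RowL2 ≃L[ℂ] RowL2, IsFredholmOp J T ∧
      ∀ f : RowL2, ‖T.symm f‖ ≤ c⁻¹ * (2 + B * rowMulBound) * ‖f‖ := by
  obtain ⟨L, hL, hLf⟩ := exists_multiplication_operator (aestronglyMeasurable_rowMul hm)
    (mul_nonneg hB rowMulBound_nonneg) (hb.mono fun z hz => norm_rowMul_le hz)
  obtain ⟨T, hT, hTs⟩ := exists_equiv_add_starProjection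
    (lowerHardy (EuclideanSpace ℂ (Fin 2))) L hc hc1 (fun f => by
      refine le_re_inner_of_ae_le f (f + L f) ?_
      filter_upwards [hJ, hLf f, Lp.coeFn_add f (L f)] with z h1 h2 h3
      rw [h3, Pi.add_apply, h2]
      exact h1 _)
  refine ⟨T, fun f => ?_, fun f => (hTs f).trans ?_⟩
  -- The sign comes from `𝒫⁻ = -Π`, so `f - 𝒫⁻(fJ)` is `f + Π(fJ)`.
  · refine ⟨fun z j => -((lowerHardy _).starProjection (L f) z j), fun j => ?_, ?_⟩
    · have h := isPlemeljMinus_inner_starProjection (L f) (EuclideanSpace.single j (1 : ℂ))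
      simp_rw [inner_single_one] at h
      refine h.congr_left ?_
      filter_upwards [hLf f] with z hz
      rw [hz, rowMul_apply]
    · have h := Lp.coeFn_add f ((lowerHardy _).starProjection (L f))
      rw [← hT] at h
      filter_upwards [h] with z hz j
      rw [hz]
      simp
  · gcongr

end Multiplication

/-! ### From row vectors to the matrix equation -/

section Rows

/-- The `j`-th component of a square-integrable row vector. -/
noncomputable def rowComp (f : RowL2) (j : Fin 2) : Lp ℂ 2 (volume : Measure ℝ) :=
  (EuclideanSpace.proj j : EuclideanSpace ℂ (Fin 2) →L[ℂ] ℂ).compLp f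

theorem coeFn_rowComp (f : RowL2) (j : Fin 2) : rowComp f j =ᵐ[volume] fun z => f z j :=
  ContinuousLinearMap.coeFn_compLp _ f

/-- The square-integrable row vector with given components. -/
noncomputable def rowOf (g : Fin 2 → Lp ℂ 2 (volume : Measure ℝ)) : RowL2 :=
  ((1 : ℂ →L[ℂ] ℂ).smulRight (EuclideanSpace.single (0 : Fin 2) (1 : ℂ))).compLp (g 0) +
    ((1 : ℂ →L[ℂ] ℂ).smulRight (EuclideanSpace.single (1 : Fin 2) (1 : ℂ))).compLp (g 1)

theorem coeFn_rowOf (g : Fin 2 → Lp ℂ 2 (volume : Measure ℝ)) :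
    ∀ᵐ z : ℝ, ∀ j, rowOf g z j = g j z := by
  unfold rowOf
  filter_upwards [Lp.coeFn_add
      (((1 : ℂ →L[ℂ] ℂ).smulRight (EuclideanSpace.single (0 : Fin 2) (1 : ℂ))).compLp (g 0))
      (((1 : ℂ →L[ℂ] ℂ).smulRight (EuclideanSpace.single (1 : Fin 2) (1 : ℂ))).compLp (g 1)),
    ((1 : ℂ →L[ℂ] ℂ).smulRight
      (EuclideanSpace.single (0 : Fin 2) (1 : ℂ))).coeFn_compLp (g 0),
    ((1 : ℂ →L[ℂ] ℂ).smulRight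
      (EuclideanSpace.single (1 : Fin 2) (1 : ℂ))).coeFn_compLp (g 1)] with z h1 h2 h3 j
  rw [h1, Pi.add_apply, h2, h3]
  fin_cases j <;> simp

theorem rowL2_ext {f g : RowL2} (h : ∀ᵐ z : ℝ, ∀ j, f z j = g z j) : f = g := by
  refine Lp.ext ?_
  filter_upwards [h] with z hz
  ext j
  exact hz j

theorem rowComp_rowOf (g : Fin 2 → Lp ℂ 2 (volume : Measure ℝ)) (j : Fin 2) :
    rowComp (rowOf g) j = g j := by
  refine Lp.ext ?_
  filter_upwards [coeFn_rowComp (rowOf g) j, coeFn_rowOf g] with z h1 h2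
  rw [h1, h2]

/-- Right multiplication by `J` does not mix rows, so row `i` of `G` must be `T⁻¹` applied to row
`i` of `𝒫⁻(J)`; almost everywhere uniqueness of Plemelj limits makes this the only solution. -/
theorem existsUnique_solvesFredholm {J : ℝ → Matrix (Fin 2) (Fin 2) ℂ}
    (hJ : ∀ i j, MemLp (fun z => J z i j) 2) (T : RowL2 ≃L[ℂ] RowL2) (hT : IsFredholmOp J T) :
    ∃! G : MatL2, SolvesFredholm J G := by
  choose b hb using fun i j => exists_isPlemeljMinus (hJ i j)
  have hmul : ∀ (G : MatL2) (i : Fin 2) (f : RowL2), (∀ᵐ z : ℝ, ∀ j, f z j = G i j z) → ∀ j,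
      (fun z => Matrix.vecMul (fun i => f z i) (J z) j) =ᵐ[volume]
        fun z => (G.val z * J z) i j := by
    intro G i f hf j
    filter_upwards [hf] with z hz
    simp [Matrix.vecMul, dotProduct, Matrix.mul_apply, MatL2.val, hz]
  set f : Fin 2 → RowL2 := fun i => T.symm (rowOf (b i))
  refine ⟨fun i j => rowComp (f i) j, ?_, ?_⟩
  · choose A hA hTA using fun i => hT (f i)
    refine ⟨fun z => Matrix.of fun i j => A i z j, fun z => Matrix.of fun i j => b i j z,
      fun i j => ?_, fun i j => hb i j, ?_⟩
    · refine (hA i j).congr_left (hmul (fun i j => rowComp (f i) j) i (f i) ?_ j)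
      rw [ae_all_iff]
      exact fun j => (coeFn_rowComp (f i) j).symm
    · have h1 : ∀ᵐ z : ℝ, ∀ i j, rowComp (f i) j z = f i z j := by
        simp_rw [ae_all_iff]
        exact fun i j => coeFn_rowComp (f i) j
      have h2 : ∀ᵐ z : ℝ, ∀ i j, rowOf (b i) z j = b i j z := by
        rw [ae_all_iff]
        exact fun i => coeFn_rowOf (b i)
      filter_upwards [h1, h2, ae_all_iff.2 hTA] with z h1 h2 h3
      ext i j
      have h4 := h3 i j
      simp only [f, ContinuousLinearEquiv.apply_symm_apply, h2] at h4
      simp only [MatL2.val, Matrix.of_apply, Matrix.add_apply, h1, f]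
      rw [h4]
      ring
  · rintro G ⟨A, B, hA, hB, hG⟩
    have key : ∀ i, rowOf (G i) = f i := by
      intro i
      obtain ⟨A', hA', hTA'⟩ := hT (rowOf (G i))
      have h1 : ∀ᵐ z : ℝ, ∀ j, A' z j = A z i j := by
        rw [ae_all_iff]
        exact fun j => ((hA' j).congr_left (hmul G i _ (coeFn_rowOf (G i)) j)).ae_unique (hA i j)
      have h2 : ∀ᵐ z : ℝ, ∀ j, B z i j = b i j z := by
        rw [ae_all_iff]
        exact fun j => (hB i j).ae_unique (hb i j)
      rw [ContinuousLinearEquiv.eq_symm_apply]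
      refine rowL2_ext ?_
      filter_upwards [h1, h2, hTA', hG, coeFn_rowOf (G i), coeFn_rowOf (b i)]
        with z h1 h2 h3 h4 h5 h6 j
      have h7 := congrFun (congrFun h4 i) j
      simp only [MatL2.val, Matrix.of_apply, Matrix.add_apply] at h7
      rw [h3, h1, h6, h5, h7, h2]
      ring
    funext i j
    rw [← key i, rowComp_rowOf]

end Rows

/-! ### Bounds and coercivity for the jump matrix -/

section Jump

/-- The jump matrix in terms of `q = r e^{2izx}`; the sign `σ` is `1` on the real part of the
contour and `-1` on the imaginary part. -/
noncomputable def signedJump (σ : ℝ) (q : ℂ) : Matrix (Fin 2) (Fin 2) ℂ :=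
  !![(σ : ℂ) * (‖q‖ ^ 2 : ℂ), σ * star q; q, 0]

/-- The two cases of the jump are thus separated by the sign of `z`, whatever square roots `κ`
picks. -/
theorem IsBranch.im_eq_zero_iff {κ : ℝ → ℂ} (hκ : IsBranch κ) (z : ℝ) :
    (κ z).im = 0 ↔ 0 ≤ z := by
  have h := hκ z
  have hre := congrArg Complex.re h
  have him := congrArg Complex.im h
  simp only [pow_two, Complex.mul_re, Complex.mul_im, Complex.ofReal_re, Complex.ofReal_im]
    at hre him
  constructor
  · intro h0
    rw [h0] at hre
    nlinarith [mul_self_nonneg (κ z).re]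
  · intro hz
    by_contra h0
    have h1 : (κ z).re = 0 := by
      have : (κ z).re * (κ z).im = 0 := by linarith
      exact (mul_eq_zero.1 this).resolve_right h0
    rw [h1] at hre
    nlinarith [mul_self_pos.2 h0]

theorem norm_exp_two_I_mul (z x : ℝ) : ‖Complex.exp (2 * Complex.I * z * x)‖ = 1 := by
  have : 2 * Complex.I * (z : ℂ) * x = ((2 * z * x : ℝ) : ℂ) * Complex.I := by push_cast; ring
  rw [this, Complex.norm_exp_ofReal_mul_I]

theorem jumpJ_eq_signedJump {κ : ℝ → ℂ} (hκ : IsBranch κ) (r : ℂ → ℂ) (x z : ℝ) :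
    jumpJ r x (κ z) = signedJump (if 0 ≤ z then 1 else -1)
      (r (κ z) * Complex.exp (2 * Complex.I * z * x)) := by
  have hstar : star (r (κ z) * Complex.exp (2 * Complex.I * z * x)) =
      star (r (κ z)) * Complex.exp (-2 * Complex.I * z * x) := by
    rw [star_mul', Complex.star_def, ← Complex.exp_conj]
    simp [map_ofNat (starRingEnd ℂ) 2]
  rw [jumpJ, signedJump, norm_mul, norm_exp_two_I_mul, mul_one, hstar, hκ z]
  by_cases hz : 0 ≤ z
  · rw [if_pos ((hκ.im_eq_zero_iff z).2 hz), if_pos hz]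
    simp
  · rw [if_neg (fun h => hz ((hκ.im_eq_zero_iff z).1 h)), if_neg hz]
    simp

/-- Being linear in `‖q‖`, the bound serves twice: it puts the entries of `J` in `L²` and bounds
them uniformly. -/
theorem norm_signedJump_apply_le {σ : ℝ} (hσ : |σ| ≤ 1) {q : ℂ} {B : ℝ} (hq : ‖q‖ ≤ B)
    (i j : Fin 2) : ‖signedJump σ q i j‖ ≤ (1 + B) * ‖q‖ := by
  have h0 := norm_nonneg q
  fin_cases i <;> fin_cases j <;> simp [signedJump]
  · nlinarith [sq_nonneg ‖q‖, abs_nonneg σ]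
  · nlinarith [abs_nonneg σ]
  · nlinarith
  · nlinarith

theorem coercive_signedJump_one {q : ℂ} {ρ : ℝ} (hq : ‖q‖ ≤ ρ) (a : EuclideanSpace ℂ (Fin 2)) :
    (2 + ρ ^ 2)⁻¹ * ‖a‖ ^ 2 ≤ (inner ℂ a (a + rowMul (signedJump 1 q) a)).re := by
  have hre : (inner ℂ a (a + rowMul (signedJump 1 q) a)).re =
      ‖a 0‖ ^ 2 + ‖a 0 * star q + a 1‖ ^ 2 := by
    simp only [PiLp.inner_apply, Fin.sum_univ_two, PiLp.add_apply, rowMul_apply, signedJump,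
      Matrix.vecMul, dotProduct, ← Complex.normSq_eq_norm_sq]
    simp [Complex.normSq_apply, Complex.mul_re, Complex.mul_im, ← Complex.normSq_eq_norm_sq,
      ← Complex.ofReal_pow]
    ring
  rw [hre, EuclideanSpace.norm_sq_eq, Fin.sum_univ_two, inv_mul_le_iff₀ (by positivity)]
  set u := a 0 * star q + a 1 with hu
  have h1 : ‖a 1‖ ≤ ‖u‖ + ‖a 0‖ * ρ := by
    have : a 1 = u - a 0 * star q := by rw [hu]; ring
    rw [this]
    refine (norm_sub_le _ _).trans ?_
    rw [norm_mul, norm_star]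
    gcongr
  have hρ : 0 ≤ ρ := (norm_nonneg q).trans hq
  have h2 : ‖a 1‖ ^ 2 ≤ (‖u‖ + ‖a 0‖ * ρ) ^ 2 := by gcongr
  -- Cauchy–Schwarz gives `‖a 1‖² ≤ (1 + ρ²)(‖u‖² + ‖a 0‖²)`; the additional `‖a 0‖²` raises the
  -- constant to `2 + ρ²`.
  nlinarith [sq_nonneg (‖u‖ * ρ - ‖a 0‖), sq_nonneg ‖u‖, sq_nonneg ‖a 0‖]

theorem coercive_signedJump_neg_one {q : ℂ} {d : ℝ} (hd : d ≤ 1) (hq : d ≤ 1 - ‖q‖ ^ 2)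
    (a : EuclideanSpace ℂ (Fin 2)) :
    d * ‖a‖ ^ 2 ≤ (inner ℂ a (a + rowMul (signedJump (-1) q) a)).re := by
  -- The cross terms are purely imaginary in total, as the off-diagonal part is skew-Hermitian.
  have hre : (inner ℂ a (a + rowMul (signedJump (-1) q) a)).re =
      (1 - ‖q‖ ^ 2) * ‖a 0‖ ^ 2 + ‖a 1‖ ^ 2 := by
    simp only [PiLp.inner_apply, Fin.sum_univ_two, PiLp.add_apply, rowMul_apply, signedJump,
      Matrix.vecMul, dotProduct, ← Complex.normSq_eq_norm_sq]
    simp [Complex.normSq_apply, Complex.mul_re, Complex.mul_im, ← Complex.normSq_eq_norm_sq,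
      ← Complex.ofReal_pow]
    ring
  rw [hre, EuclideanSpace.norm_sq_eq, Fin.sum_univ_two]
  nlinarith [mul_le_mul_of_nonneg_right hq (sq_nonneg ‖a 0‖),
    mul_le_mul_of_nonneg_right hd (sq_nonneg ‖a 1‖)]

variable {κ : ℝ → ℂ} {r : ℂ → ℂ} {c₀ : ℝ}

theorem ae_norm_le_of_eLpNorm_top_le {ρ : ℝ≥0}
    (hρ : eLpNorm (fun z => r (κ z)) ⊤ (volume : Measure ℝ) ≤ ρ) : ∀ᵐ z : ℝ, ‖r (κ z)‖ ≤ ρ := by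
  rw [eLpNorm_exponent_top] at hρ
  filter_upwards [ae_le_eLpNormEssSup (f := fun z => r (κ z)) (μ := volume)] with z hz
  have := hz.trans hρ
  rw [enorm_eq_nnnorm] at this
  exact_mod_cast this

theorem IsReflection.aestronglyMeasurable_jumpJ (hr : IsReflection κ r c₀) (hκ : IsBranch κ)
    (x : ℝ) (i j : Fin 2) : AEStronglyMeasurable fun z => jumpJ r x (κ z) i j := by
  simp_rw [jumpJ_eq_signedJump hκ]
  have hσ : Measurable fun z : ℝ => (if 0 ≤ z then (1 : ℝ) else -1) :=
    Measurable.ite measurableSet_Ici measurable_const measurable_const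
  have he : Measurable fun z : ℝ => Complex.exp (2 * Complex.I * z * x) := by fun_prop
  have hq : AEMeasurable fun z => r (κ z) * Complex.exp (2 * Complex.I * z * x) :=
    hr.memLp_two.1.aemeasurable.mul he.aemeasurable
  have hσ' : AEMeasurable fun z : ℝ => (((if 0 ≤ z then (1 : ℝ) else -1) : ℝ) : ℂ) :=
    (Complex.measurable_ofReal.comp hσ).aemeasurable
  refine AEMeasurable.aestronglyMeasurable ?_
  fin_cases i <;> fin_cases j
  · exact hσ'.mul ((Complex.measurable_ofReal.comp_aemeasurable hq.norm).pow_const 2)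
  · exact hσ'.mul (Complex.continuous_conj.measurable.comp_aemeasurable hq)
  · exact hq
  · exact aemeasurable_const

theorem abs_sign_le (z : ℝ) : |if 0 ≤ z then (1 : ℝ) else -1| ≤ 1 := by
  split_ifs <;> simp

theorem ae_norm_jumpJ_le (hκ : IsBranch κ) {ρ : ℝ≥0}
    (hρ : eLpNorm (fun z => r (κ z)) ⊤ (volume : Measure ℝ) ≤ ρ) (x : ℝ) :
    ∀ᵐ z : ℝ, ∀ i j, ‖jumpJ r x (κ z) i j‖ ≤ (1 + ρ) * ‖r (κ z)‖ := by
  filter_upwards [ae_norm_le_of_eLpNorm_top_le hρ] with z hz i j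
  have hn : ‖r (κ z) * Complex.exp (2 * Complex.I * z * x)‖ = ‖r (κ z)‖ := by
    rw [norm_mul, norm_exp_two_I_mul, mul_one]
  rw [jumpJ_eq_signedJump hκ]
  refine (norm_signedJump_apply_le (B := ρ) (abs_sign_le z) (by rwa [hn]) i j).trans ?_
  rw [hn]

theorem IsReflection.memLp_jumpJ (hr : IsReflection κ r c₀) (hκ : IsBranch κ) (x : ℝ)
    (i j : Fin 2) : MemLp (fun z => jumpJ r x (κ z) i j) 2 := by
  refine hr.memLp_two.of_le_mul (hr.aestronglyMeasurable_jumpJ hκ x i j) ?_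
    (c := 1 + ((eLpNorm (fun z => r (κ z)) ⊤ (volume : Measure ℝ)).toNNReal : ℝ))
  filter_upwards [ae_norm_jumpJ_le hκ (ENNReal.coe_toNNReal hr.memLp_top.2.ne).ge x] with z hz
  exact hz i j

theorem IsReflection.ae_coercive (hr : IsReflection κ r c₀) (hκ : IsBranch κ) {ρ : ℝ≥0}
    (hρ : eLpNorm (fun z => r (κ z)) ⊤ (volume : Measure ℝ) ≤ ρ) (x : ℝ) :
    ∀ᵐ z : ℝ, ∀ a : EuclideanSpace ℂ (Fin 2),
      min (c₀ ^ 2) (2 + (ρ : ℝ) ^ 2)⁻¹ * ‖a‖ ^ 2 ≤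
        (inner ℂ a (a + rowMul (jumpJ r x (κ z)) a)).re := by
  filter_upwards [ae_norm_le_of_eLpNorm_top_le hρ, hr.gap] with z hz hgap a
  have hn : ‖r (κ z) * Complex.exp (2 * Complex.I * z * x)‖ = ‖r (κ z)‖ := by
    rw [norm_mul, norm_exp_two_I_mul, mul_one]
  rw [jumpJ_eq_signedJump hκ]
  split_ifs with h
  · refine le_trans ?_ (coercive_signedJump_one (ρ := ρ) (by rwa [hn]) a)
    gcongr
    exact min_le_right _ _
  · have hg := hgap (not_le.1 h)
    refine le_trans ?_ (coercive_signedJump_neg_one (d := c₀ ^ 2)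
      (by nlinarith [sq_nonneg ‖r (κ z)‖]) (by rwa [hn]) a)
    gcongr
    exact min_le_left _ _

theorem exists_fredholmOp_jumpJ (c₀ : ℝ) (ρ : ℝ≥0) (hc₀ : 0 < c₀) : ∃ C : ℝ, 0 < C ∧
    ∀ (κ : ℝ → ℂ) (r : ℂ → ℂ) (x : ℝ), IsBranch κ → IsReflection κ r c₀ →
      eLpNorm (fun z => r (κ z)) ⊤ (volume : Measure ℝ) ≤ ρ →
      ∃ T : RowL2 ≃L[ℂ] RowL2,
        IsFredholmOp (fun z => jumpJ r x (κ z)) T ∧ ∀ f : RowL2, ‖T.symm f‖ ≤ C * ‖f‖ := by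
  have hc : 0 < min (c₀ ^ 2) (2 + (ρ : ℝ) ^ 2)⁻¹ := lt_min (by positivity) (by positivity)
  have hB : 0 ≤ (1 + (ρ : ℝ)) * ρ := by positivity
  have hR := rowMulBound_nonneg
  refine ⟨(min (c₀ ^ 2) (2 + (ρ : ℝ) ^ 2)⁻¹)⁻¹ * (2 + (1 + ρ) * ρ * rowMulBound), by positivity,
    fun κ r x hκ hr hρ => ?_⟩
  refine exists_fredholmOp (hr.aestronglyMeasurable_jumpJ hκ x) hB ?_ hc ?_
    (hr.ae_coercive hκ hρ x)
  · filter_upwards [ae_norm_jumpJ_le hκ hρ x, ae_norm_le_of_eLpNorm_top_le hρ] with z h1 h2 i j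
    exact (h1 i j).trans (by gcongr)
  · exact (min_le_right _ _).trans (inv_le_one_of_one_le₀ (by nlinarith [sq_nonneg (ρ : ℝ)]))

end Jump

theorem mainTheorem5 :
    (∀ (c₀ : ℝ) (κ : ℝ → ℂ) (r : ℂ → ℂ) (x : ℝ), 0 < c₀ → IsBranch κ → IsReflection κ r c₀ →
      ∃! G : MatL2, SolvesFredholm (fun z => jumpJ r x (κ z)) G) ∧
    (∀ (c₀ : ℝ) (ρ : ℝ≥0), 0 < c₀ → ∃ C : ℝ, 0 < C ∧
      ∀ (κ : ℝ → ℂ) (r : ℂ → ℂ) (x : ℝ), IsBranch κ → IsReflection κ r c₀ →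
        eLpNorm (fun z => r (κ z)) ⊤ (volume : Measure ℝ) ≤ ρ →
        ∃ T : RowL2 ≃L[ℂ] RowL2,
          IsFredholmOp (fun z => jumpJ r x (κ z)) T ∧
          ∀ f : RowL2, ‖T.symm f‖ ≤ C * ‖f‖) := by
  refine ⟨fun c₀ κ r x hc₀ hκ hr => ?_, exists_fredholmOp_jumpJ⟩
  -- For a single `r`, the essential supremum itself serves as the bound `ρ`.
  obtain ⟨C, -, hC⟩ := exists_fredholmOp_jumpJ c₀
    (eLpNorm (fun z => r (κ z)) ⊤ (volume : Measure ℝ)).toNNReal hc₀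
  obtain ⟨T, hT, -⟩ := hC κ r x hκ hr (ENNReal.coe_toNNReal hr.memLp_top.2.ne).ge
  exact existsUnique_solvesFredholm (hr.memLp_jumpJ hκ x) T hT
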